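/- **Setting.** Let $X_1,\dots,X_n$ be i.i.d. from a probability measure $P_0$ on a measurable space $(\mathcal X,\mathcal B)$. For each $n$ let $W_{n1},\dots,W_{nn}$ be i.i.d. with law $Q_n$ on a measurable space $(\mathcal W_n,\mathcal C_n)$, independent of the data, and let $X_i^*=\gamma_n(X_1,\dots,X_n,W_{ni})$ with $\gamma_n$ a fixed jointly measurable function. Let $\hat P_n$ be the conditional law of $X_i^*$ given $X_1,\dots,X_n$ (the law of $\gamma_n(X_1,\dots,X_n,W)$ for $W\sim Q_n$), let $\mathbb P_n^*$ be the empirical distribution of $X_1^*,\dots,X_n^*$, and let $\mathbb G_n^*=n^{1/2}(\mathbb P_n^*-\hat P_n)$. Write $Pf=\int f\,dP$. Let $\mathcal H$ be a set and let $T$ be a real-valued function of $(\eta,P)$, with $\eta\in\mathcal H$ and $P$ a probability measure on $(\mathcal X,\mathcal B)$. Let $\eta_n\in\mathcal H$ be a function of the data, and let $\eta_n^*\in\mathcal H$ and $\phi_n^*:\mathcal X\to\mathbb R$ be functions of the data and of $W_{n1},\dots,W_{nn}$ (no measurability is assumed of them). Let $\phi_0:\mathcal X\to\mathbb R$ be a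 fixed function (the influence function), and set $$R_n^*=T(\eta_n^*,\mathbb P_n^*)-T(\eta_n,\hat P_n)-(\mathbb P_n^*-\hat P_n)\phi_n^*.$$ **Conditional convergence.** $P_0^*$ is outer probability for the data, and $Z_n\xrightarrow{P_0^*}c$ means $P_0^*(|Z_n-c|\ge\varepsilon)\to0$ for all $\varepsilon>0$. For a bounded function $h$ of $(x_1,\dots,x_n,w_1,\dots,w_n)$, $E_W^*h$ is the conditional outer expectation given the data: the infimum of $\int U\,dQ_n^n$ over measurable $U$ on $\mathcal W_n^n$ with $U\ge h(X_1,\dots,X_n,\cdot)$ almost surely and $U$ integrable; and $P_W^*(A)=E_W^*1_A$. For $r_n>0$, $Y_n=o_{P_W^*}(r_n)$ means that $P_W^*(|Y_n|\ge\varepsilon r_n)\xrightarrow{P_0^*}0$ for every $\varepsilon>0$. For a metric space $\mathbb D$ let $\mathrm{BL}_1(\mathbb D)$ be the set of 1-Lipschitz functions $\mathbb D\to[-1,1]$. Possibly non-measurable $\mathbb D$-valued $G_n$ converge weakly, conditionally in outer probability, to a tight Borel measurable $G$ in $\mathbb D$ if $$\sup_{h\in\mathrm{BL}_1(\mathbb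 D)}\bigl|E_W^*h(G_n)-E\,h(G)\bigr|\xrightarrow{P_0^*}0.$$ For a set $\mathcal F$ of functions, $\ell^\infty(\mathcal F)$ is the Banach space of bounded functions $\mathcal F\to\mathbb R$ with the supremum norm. **Theorem.** Assume: (B1) There is a class $\mathcal F$ of measurable functions $\mathcal X\to\mathbb R$ such that (a) $\phi_0\in\mathcal F$ and $P_W^*(\phi_n^*\notin\mathcal F)\xrightarrow{P_0^*}0$; and (b) $\mathbb G_n^*$ converges weakly, conditionally in outer probability, to $\mathbb G_0$ in $\ell^\infty(\mathcal F)$, where $\mathbb G_0$ is the $P_0$-Brownian bridge: a tight, Borel measurable, mean-zero Gaussian process in $\ell^\infty(\mathcal F)$ with covariance $P_0(fg)-P_0f\,P_0g$, where $\mathcal F\subset L_2(P_0)$. (It is implicit in (b) that for every $n\ge1$, almost surely, every $f\in\mathcal F$ is $\hat P_n$-integrable and $f\mapsto\mathbb G_n^*f$ is bounded on $\mathcal F$.) (B2) $\|\phi_n^*-\phi_0\|_{L_2(P_0)}=o_{P_W^*}(1)$. (B3) $R_n^*=o_{P_W^*}(n^{-1/2})$. Then $T(\eta_n^*,\mathbb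 P_n^*)$ is conditionally asymptotically linear, $$T(\eta_n^*,\mathbb P_n^*)=T(\eta_n,\hat P_n)+(\mathbb P_n^*-\hat P_n)\phi_0+o_{P_W^*}(n^{-1/2}),$$ and $n^{1/2}\bigl[T(\eta_n^*,\mathbb P_n^*)-T(\eta_n,\hat P_n)\bigr]$ converges weakly in $\mathbb R$, conditionally in outer probability, to $\mathbb G_0(\phi_0)$. -/

import Mathlib

open MeasureTheory ProbabilityTheory Filter Topology
open scoped ENNReal

namespace CondBootstrap

noncomputable section

/-! ### Outer expectations, conditional outer convergence -/

/-- The outer expectation of a bounded, possibly non-measurable function `h` on a probability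
space: the infimum of the expectations of the measurable functions `U` with `h ≤ U` almost surely.
(For bounded `h`, the only case used below, majorants with infinite expectation do not
change the infimum.) -/
def outerExp {Ω : Type*} [MeasurableSpace Ω] (μ : Measure Ω) (h : Ω → ℝ) : ℝ :=
  sInf {c : ℝ | ∃ U : Ω → ℝ, Measurable U ∧ Integrable U μ ∧ (∀ᵐ ω ∂μ, h ω ≤ U ω) ∧
    ∫ ω, U ω ∂μ = c}

/-- The outer probability of an arbitrary set: the outer expectation of its indicator. -/
def outerProb {Ω : Type*} [MeasurableSpace Ω] (μ : Measure Ω) (A : Set Ω) : ℝ :=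
  outerExp μ (A.indicator fun _ => (1 : ℝ))

variable {X : Type*} [MeasurableSpace X] {W : ℕ → Type*} [∀ n, MeasurableSpace (W n)]

/-- `Z_n → c` in outer probability, for arbitrary functions `Z_n` of an i.i.d. sample
`X_1, …, X_n` from `P₀`. -/
def TendstoInOuterProb (P₀ : Measure X) (Z : ∀ n, (Fin n → X) → ℝ) (c : ℝ) : Prop :=
  ∀ ε : ℝ, 0 < ε →
    Tendsto (fun n => outerProb (Measure.pi fun _ : Fin n => P₀) {x | ε ≤ |Z n x - c|})
      atTop (𝓝 0)

/-- The conditional outer expectation `E_W^* h` given the data `x = (x_1, …, x_n)`, where the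
auxiliary variables `w_1, …, w_n` are i.i.d. from `Q n`. -/
def condOuterExp (Q : ∀ n, Measure (W n)) (n : ℕ) (h : (Fin n → X) → (Fin n → W n) → ℝ)
    (x : Fin n → X) : ℝ :=
  outerExp (Measure.pi fun _ : Fin n => Q n) (h x)

/-- The conditional outer probability `P_W^*` of the event `A` given the data. -/
def condOuterProb (Q : ∀ n, Measure (W n)) (n : ℕ) (A : (Fin n → X) → Set (Fin n → W n))
    (x : Fin n → X) : ℝ :=
  outerProb (Measure.pi fun _ : Fin n => Q n) (A x)

/-- `Y_n = o_{P_W^*}(r_n)` for `[0, ∞]`-valued `Y_n` (real `Y_n` enter through `|Y_n|`) and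
positive rates `r_n`: for every `ε > 0`, `P_W^*(Y_n ≥ ε r_n) → 0` in outer probability. -/
def IsCondLittleO (P₀ : Measure X) (Q : ∀ n, Measure (W n))
    (Y : ∀ n, (Fin n → X) → (Fin n → W n) → ℝ≥0∞) (r : ℕ → ℝ) : Prop :=
  ∀ ε : ℝ, 0 < ε →
    TendstoInOuterProb P₀
      (fun n => condOuterProb Q n fun x => {w | ENNReal.ofReal (ε * r n) ≤ Y n x w}) 0

/-- `BL₁(D)`: the 1-Lipschitz functions `D → [-1, 1]`. -/
def BL₁ (D : Type*) [PseudoMetricSpace D] : Set (D → ℝ) :=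
  {h | LipschitzWith 1 h ∧ ∀ z, |h z| ≤ 1}

/-- `G` is a Borel measurable map into the metric space `D` whose law is tight. -/
def IsTightBorel {Ω D : Type*} [MeasurableSpace Ω] [PseudoMetricSpace D] (μ : Measure Ω)
    (G : Ω → D) : Prop :=
  (∀ U : Set D, IsOpen U → MeasurableSet (G ⁻¹' U)) ∧
    ∀ ε : ℝ≥0∞, 0 < ε → ∃ K : Set D, IsCompact K ∧ μ {ω | G ω ∉ K} ≤ ε

/-- Conditional weak convergence in outer probability of (possibly non-measurable) `D`-valued
`G_n`, given the data, to the tight Borel measurable limit `G`: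
`sup_{h ∈ BL₁(D)} |E_W^* h(G_n) - E h(G)| → 0` in outer probability. -/
def CondWeakConv {Ω D : Type*} [MeasurableSpace Ω] [PseudoMetricSpace D] (P₀ : Measure X)
    (Q : ∀ n, Measure (W n)) (Gn : ∀ n, (Fin n → X) → (Fin n → W n) → D)
    (μ : Measure Ω) (G : Ω → D) : Prop :=
  IsTightBorel μ G ∧
    TendstoInOuterProb P₀
      (fun n x => ⨆ h : BL₁ D,
        |condOuterExp Q n (fun x w => h.1 (Gn n x w)) x - ∫ ω, h.1 (G ω) ∂μ|) 0

/-! ### The bootstrap -/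

/-- The empirical distribution of `x_1, …, x_n`. -/
def empirical {n : ℕ} (x : Fin n → X) : Measure X :=
  (n : ℝ≥0∞)⁻¹ • ∑ i, Measure.dirac (x i)

/-- The bootstrap sampling distribution `P̂_n`: the conditional law of
`X_i^* = γ_n(X_1, …, X_n, W_{ni})` given `X_1, …, X_n`. -/
def Phat (Q : ∀ n, Measure (W n)) (γ : ∀ n, (Fin n → X) → W n → X) (n : ℕ) (x : Fin n → X) :
    Measure X :=
  (Q n).map (γ n x)

/-- The bootstrap empirical distribution `P_n^*`: the empirical distribution of
`X_1^*, …, X_n^*`. -/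
def Pstar (γ : ∀ n, (Fin n → X) → W n → X) (n : ℕ) (x : Fin n → X) (w : Fin n → W n) :
    Measure X :=
  empirical fun i => γ n x (w i)

/-- `(P_n^* - P̂_n) f`. -/
def centered (Q : ∀ n, Measure (W n)) (γ : ∀ n, (Fin n → X) → W n → X) (n : ℕ)
    (x : Fin n → X) (w : Fin n → W n) (f : X → ℝ) : ℝ :=
  ∫ y, f y ∂(Pstar γ n x w) - ∫ y, f y ∂(Phat Q γ n x)

/-- The Banach space `ℓ^∞(F)` of bounded functions `F → ℝ` with the supremum norm. -/
abbrev EllInf (F : Set (X → ℝ)) : Type _ := lp (fun _ : F => ℝ) ∞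

/-- The bootstrap empirical process `f ↦ n^{1/2} (P_n^* - P̂_n) f` on `F`. -/
def bootProcessFun (Q : ∀ n, Measure (W n)) (γ : ∀ n, (Fin n → X) → W n → X)
    (F : Set (X → ℝ)) (n : ℕ) (x : Fin n → X) (w : Fin n → W n) : F → ℝ :=
  fun f => √(n : ℝ) * centered Q γ n x w f.1

/-- For every sample size, almost surely, the bootstrap empirical process is defined on all
of `F` and has a bounded sample path. -/
def BootProcessInEllInf (P₀ : Measure X) (Q : ∀ n, Measure (W n))
    (γ : ∀ n, (Fin n → X) → W n → X) (F : Set (X → ℝ)) : Prop :=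
  ∀ n : ℕ, 0 < n → ∀ᵐ x ∂(Measure.pi fun _ : Fin n => P₀),
    (∀ f ∈ F, Integrable f (Phat Q γ n x)) ∧
    ∀ᵐ w ∂(Measure.pi fun _ : Fin n => Q n), Memℓp (bootProcessFun Q γ F n x w) ∞

open scoped Classical in
/-- The bootstrap empirical process `G_n^*` as an element of `ℓ^∞(F)`, with the value `0`
where its sample path is unbounded. -/
def bootProcess (Q : ∀ n, Measure (W n)) (γ : ∀ n, (Fin n → X) → W n → X)
    (F : Set (X → ℝ)) (n : ℕ) (x : Fin n → X) (w : Fin n → W n) : EllInf F :=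
  if h : Memℓp (bootProcessFun Q γ F n x w) ∞ then ⟨bootProcessFun Q γ F n x w, h⟩ else 0

/-- `G₀` is a `P₀`-Brownian bridge indexed by `F ⊆ L₂(P₀)`: a mean zero Gaussian process with
covariance `P₀(fg) - P₀f P₀g`. -/
structure IsBrownianBridge {Ω : Type*} [MeasurableSpace Ω] (P₀ : Measure X) (F : Set (X → ℝ))
    (μ : Measure Ω) (G₀ : Ω → EllInf F) : Prop where
  memLp : ∀ f ∈ F, MemLp f 2 P₀
  gaussian : IsGaussianProcess (fun (f : F) (ω : Ω) => (G₀ ω : F → ℝ) f) μ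
  mean : ∀ f : F, ∫ ω, (G₀ ω : F → ℝ) f ∂μ = 0
  covar : ∀ f g : F,
    cov[fun ω => (G₀ ω : F → ℝ) f, fun ω => (G₀ ω : F → ℝ) g; μ]
      = ∫ y, f.1 y * g.1 y ∂P₀ - (∫ y, f.1 y ∂P₀) * ∫ y, g.1 y ∂P₀

/-- The centered bootstrap estimator `T(η_n^*, P_n^*) - T(η_n, P̂_n)`. -/
def bootDiff {H : Type*} (Q : ∀ n, Measure (W n)) (γ : ∀ n, (Fin n → X) → W n → X)
    (T : H → Measure X → ℝ) (η : ∀ n, (Fin n → X) → H)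
    (ηstar : ∀ n, (Fin n → X) → (Fin n → W n) → H) (n : ℕ) (x : Fin n → X)
    (w : Fin n → W n) : ℝ :=
  T (ηstar n x w) (Pstar γ n x w) - T (η n x) (Phat Q γ n x)

/-- The remainder `R_n^* = T(η_n^*, P_n^*) - T(η_n, P̂_n) - (P_n^* - P̂_n) φ_n^*`. -/
def bootRemainder {H : Type*} (Q : ∀ n, Measure (W n)) (γ : ∀ n, (Fin n → X) → W n → X)
    (T : H → Measure X → ℝ) (η : ∀ n, (Fin n → X) → H)
    (ηstar : ∀ n, (Fin n → X) → (Fin n → W n) → H)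
    (φstar : ∀ n, (Fin n → X) → (Fin n → W n) → X → ℝ) (n : ℕ) (x : Fin n → X)
    (w : Fin n → W n) : ℝ :=
  bootDiff Q γ T η ηstar n x w - centered Q γ n x w (φstar n x w)

end

end CondBootstrap

open CondBootstrap

namespace CondBootstrap

/-! ### Calculus of outer expectations. -/

section OuterExpectation

variable {Ω : Type*} [MeasurableSpace Ω] {μ : Measure Ω} [IsProbabilityMeasure μ]

/-! Replacing `φstar` by `φ₀` in the expansion costs $\mathbb G_n^*(\phi_n^*-\phi_0)$, up to the
remainder. Since $\phi_n^*$ is eventually in $\mathcal F$ and $L_2(P_0)$-close to $\phi_0$, this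
cost is at most the modulus of continuity of $\mathbb G_n^*$ at the single point $\phi_0$. It thus
suffices that this modulus be small, in conditional outer probability.

For the limit $\mathbb G_0$ this is `IsBrownianBridge.exists_modulus`. Chebyshev's inequality makes
each single increment small, and tightness makes the smallness uniform in $f$: on a compact set of
paths, finitely many indices near $\phi_0$ control all the others. No entropy bound or Gaussian
maximal inequality is needed.

The smallness passes to $\mathbb G_n^*$ because half the modulus, truncated at 1, is a test function
in `BL₁`; Markov's inequality for outer expectations then bounds the probability of a large modulus
(`isCondLittleO_sub_centered`). Given linearity, weak convergence follows by composing test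
functions on $\mathbb R$ with evaluation at $\phi_0$, which is 1-Lipschitz
(`condWeakConv_of_isCondLittleO`). -/

theorem outerExp_set_nonempty {h : Ω → ℝ} {M : ℝ} (hM : ∀ ω, h ω ≤ M) :
    {c : ℝ | ∃ U : Ω → ℝ, Measurable U ∧ Integrable U μ ∧ (∀ᵐ ω ∂μ, h ω ≤ U ω) ∧
      ∫ ω, U ω ∂μ = c}.Nonempty :=
  ⟨_, fun _ => M, measurable_const, integrable_const _, ae_of_all _ hM, rfl⟩

theorem outerExp_set_bddBelow {h : Ω → ℝ} {m : ℝ} (hm : ∀ ω, m ≤ h ω) :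
    BddBelow {c : ℝ | ∃ U : Ω → ℝ, Measurable U ∧ Integrable U μ ∧ (∀ᵐ ω ∂μ, h ω ≤ U ω) ∧
      ∫ ω, U ω ∂μ = c} := by
  refine ⟨m, ?_⟩
  rintro _ ⟨U, -, hU, hle, rfl⟩
  have := integral_mono_ae (integrable_const m) hU (hle.mono fun ω h' => (hm ω).trans h')
  simpa using this

theorem le_outerExp {h : Ω → ℝ} {m M : ℝ} (hm : ∀ ω, m ≤ h ω) (hM : ∀ ω, h ω ≤ M) :
    m ≤ outerExp μ h := by
  refine le_csInf (outerExp_set_nonempty hM) ?_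
  rintro _ ⟨U, -, hU, hle, rfl⟩
  have := integral_mono_ae (integrable_const m) hU (hle.mono fun ω h' => (hm ω).trans h')
  simpa using this

theorem outerExp_le {h : Ω → ℝ} {m M : ℝ} (hm : ∀ ω, m ≤ h ω) (hM : ∀ ω, h ω ≤ M) :
    outerExp μ h ≤ M :=
  csInf_le (outerExp_set_bddBelow hm)
    ⟨fun _ => M, measurable_const, integrable_const _, ae_of_all _ hM, by simp⟩

/-- Markov's inequality for outer expectations. -/
theorem mul_measureReal_le_outerExp {h : Ω → ℝ} {M c : ℝ} {A : Set Ω} (hc : 0 < c)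
    (h0 : ∀ ω, 0 ≤ h ω) (hM : ∀ ω, h ω ≤ M) (hA : ∀ ω ∈ A, c ≤ h ω) :
    c * μ.real A ≤ outerExp μ h := by
  refine le_csInf (outerExp_set_nonempty hM) ?_
  rintro _ ⟨U, -, hU, hle, rfl⟩
  refine le_trans ?_ (mul_meas_ge_le_integral_of_nonneg
    (hle.mono fun ω h' => (h0 ω).trans h') hU c)
  refine mul_le_mul_of_nonneg_left (ENNReal.toReal_mono (measure_ne_top _ _) ?_) hc.le
  refine measure_mono_ae (hle.mono fun ω h' hω => ?_)
  exact (hA ω hω).trans h'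

/-- If `U` majorizes `g`, then `U + a`, raised by `b` on a measurable hull of `A`, majorizes `h`.
The hull has the outer measure of `A`, so `A` need not be measurable. -/
theorem outerExp_le_add {h g : Ω → ℝ} {m M a b : ℝ} {A : Set Ω} (hm : ∀ ω, m ≤ h ω)
    (hM : ∀ ω, g ω ≤ M) (h1 : ∀ ω, ω ∉ A → h ω ≤ g ω + a)
    (h2 : ∀ ω, h ω ≤ g ω + a + b) :
    outerExp μ h ≤ outerExp μ g + a + b * μ.real A := by
  suffices outerExp μ h - a - b * μ.real A ≤ outerExp μ g by linarith
  refine le_csInf (outerExp_set_nonempty hM) ?_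
  rintro _ ⟨U, hUm, hU, hle, rfl⟩
  have hB : MeasurableSet (toMeasurable μ A) := measurableSet_toMeasurable _ _
  have hI : Integrable ((toMeasurable μ A).indicator fun _ => b) μ :=
    (integrable_const b).indicator hB
  have hUa : Integrable (fun ω => U ω + a) μ := hU.add (integrable_const a)
  have : outerExp μ h ≤
      ∫ ω, (U ω + a + (toMeasurable μ A).indicator (fun _ => b) ω) ∂μ := by
    refine csInf_le (outerExp_set_bddBelow hm) ⟨_, ?_, ?_, ?_, rfl⟩
    · exact (hUm.add_const a).add (measurable_const.indicator hB)
    · exact hUa.add hI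
    · filter_upwards [hle] with ω hω
      by_cases hA : ω ∈ toMeasurable μ A
      · rw [Set.indicator_of_mem hA]; linarith [h2 ω]
      · rw [Set.indicator_of_notMem hA]
        linarith [h1 ω fun h' => hA (subset_toMeasurable _ _ h')]
  rw [integral_add hUa hI, integral_add hU (integrable_const a),
    integral_indicator_const _ hB] at this
  simp only [integral_const, probReal_univ, smul_eq_mul, one_mul] at this
  have e : μ.real (toMeasurable μ A) = μ.real A := by
    simp [Measure.real, measure_toMeasurable]
  rw [e] at this
  linarith

theorem outerExp_zero : outerExp μ (fun _ => (0 : ℝ)) = 0 :=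
  le_antisymm (outerExp_le (m := 0) (by simp) (by simp)) (le_outerExp (M := 0) (by simp) (by simp))

/-- Outer probability is the outer measure. -/
theorem outerProb_eq (A : Set Ω) : outerProb μ A = μ.real A := by
  classical
  have h0 : ∀ ω, (0 : ℝ) ≤ A.indicator (fun _ => (1 : ℝ)) ω :=
    fun ω => Set.indicator_nonneg (by simp) ω
  have h1 : ∀ ω, A.indicator (fun _ => (1 : ℝ)) ω ≤ 1 := fun ω => by
    by_cases h : ω ∈ A <;> simp [h]
  apply le_antisymm
  · have := outerExp_le_add (μ := μ) (h := A.indicator fun _ => (1 : ℝ)) (g := fun _ => 0)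
      (a := 0) (b := 1) (A := A) (M := 0) h0 (by simp)
      (fun ω h => by simp [h]) (fun ω => by simpa using h1 ω)
    simpa [outerExp_zero, outerProb] using this
  · have := mul_measureReal_le_outerExp (μ := μ) (A := A) (c := 1) one_pos h0 h1
      (fun ω h => by simp [h])
    simpa [outerProb] using this

/-- Two functions with values in `[-1, 1]` that are `a`-close off `A` have outer expectations
that differ by at most `a + 2 μ(A)`. -/
theorem abs_outerExp_sub_le {h g : Ω → ℝ} {a : ℝ} {A : Set Ω} (ha : 0 ≤ a)
    (hh : ∀ ω, |h ω| ≤ 1) (hg : ∀ ω, |g ω| ≤ 1) (h1 : ∀ ω, ω ∉ A → |h ω - g ω| ≤ a) :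
    |outerExp μ h - outerExp μ g| ≤ a + 2 * μ.real A := by
  have e1 := outerExp_le_add (μ := μ) (h := h) (g := g) (a := a) (b := 2) (A := A)
    (fun ω => (abs_le.1 (hh ω)).1) (fun ω => (abs_le.1 (hg ω)).2)
    (fun ω hω => by linarith [(abs_le.1 (h1 ω hω)).2])
    (fun ω => by linarith [(abs_le.1 (hg ω)).1, (abs_le.1 (hh ω)).2])
  have e2 := outerExp_le_add (μ := μ) (h := g) (g := h) (a := a) (b := 2) (A := A)
    (fun ω => (abs_le.1 (hg ω)).1) (fun ω => (abs_le.1 (hh ω)).2)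
    (fun ω hω => by linarith [(abs_le.1 (h1 ω hω)).1])
    (fun ω => by linarith [(abs_le.1 (hh ω)).1, (abs_le.1 (hg ω)).2])
  exact abs_le.2 ⟨by linarith, by linarith⟩

end OuterExpectation

/-! ### Convergence to zero in outer probability. -/

section OuterConvergence

variable {X : Type*} [MeasurableSpace X] {P₀ : Measure X} [IsProbabilityMeasure P₀]

theorem tendstoInOuterProb_zero_iff {Z : ∀ n, (Fin n → X) → ℝ} :
    TendstoInOuterProb P₀ Z 0 ↔ ∀ ε : ℝ, 0 < ε →
      Tendsto (fun n => (Measure.pi fun _ : Fin n => P₀).real {x | ε ≤ |Z n x|}) atTop (𝓝 0) := by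
  simp only [TendstoInOuterProb, outerProb_eq, sub_zero]

theorem TendstoInOuterProb.add {Z Z' : ∀ n, (Fin n → X) → ℝ} (hZ : TendstoInOuterProb P₀ Z 0)
    (hZ' : TendstoInOuterProb P₀ Z' 0) :
    TendstoInOuterProb P₀ (fun n x => Z n x + Z' n x) 0 := by
  rw [tendstoInOuterProb_zero_iff] at *
  intro ε hε
  have := (hZ (ε / 2) (half_pos hε)).add (hZ' (ε / 2) (half_pos hε))
  rw [add_zero] at this
  refine squeeze_zero (fun _ => measureReal_nonneg) (fun n => ?_) this
  refine (measureReal_mono fun x hx => ?_).trans (measureReal_union_le _ _)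
  simp only [Set.mem_union, Set.mem_ofPred_eq] at hx ⊢
  by_contra! hcon
  linarith [abs_add_le (Z n x) (Z' n x)]

theorem TendstoInOuterProb.const_mul {Z : ∀ n, (Fin n → X) → ℝ}
    (hZ : TendstoInOuterProb P₀ Z 0) {c : ℝ} (hc : 0 < c) :
    TendstoInOuterProb P₀ (fun n x => c * Z n x) 0 := by
  rw [tendstoInOuterProb_zero_iff] at *
  intro ε hε
  refine (hZ (ε / c) (div_pos hε hc)).congr fun n => ?_
  congr 1
  ext x
  simp only [Set.mem_ofPred_eq, abs_mul, abs_of_pos hc]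
  rw [div_le_iff₀' hc]

/-- A sequence that is dominated almost surely, up to an arbitrarily small constant, by sequences
that tend to zero in outer probability tends to zero in outer probability. -/
theorem tendstoInOuterProb_zero_of_le {Z : ∀ n, (Fin n → X) → ℝ}
    (h : ∀ τ : ℝ, 0 < τ → ∃ Z' : ∀ n, (Fin n → X) → ℝ, TendstoInOuterProb P₀ Z' 0 ∧
      ∀ᶠ n in atTop, ∀ᵐ x ∂(Measure.pi fun _ : Fin n => P₀), |Z n x| ≤ τ + Z' n x) :
    TendstoInOuterProb P₀ Z 0 := by
  rw [tendstoInOuterProb_zero_iff]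
  intro ε hε
  obtain ⟨Z', hZ', hle⟩ := h (ε / 2) (half_pos hε)
  rw [tendstoInOuterProb_zero_iff] at hZ'
  refine squeeze_zero' (Eventually.of_forall fun _ => measureReal_nonneg) ?_
    (hZ' (ε / 2) (half_pos hε))
  filter_upwards [hle] with n hn
  refine ENNReal.toReal_mono (measure_ne_top _ _) (measure_mono_ae ?_)
  filter_upwards [hn] with x hx hεx
  have hεx : ε ≤ |Z n x| := hεx
  change ε / 2 ≤ |Z' n x|
  linarith [le_abs_self (Z' n x)]

end OuterConvergence

theorem EllInf.abs_apply_sub_le {X : Type*} {F : Set (X → ℝ)} (z z' : EllInf F) (f : F) :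
    |(z : F → ℝ) f - (z' : F → ℝ) f| ≤ dist z z' := by
  rw [dist_eq_norm]
  exact lp.norm_apply_le_norm ENNReal.top_ne_zero (z - z') f

theorem EllInf.abs_apply_le {X : Type*} {F : Set (X → ℝ)} (z : EllInf F) (f : F) : |(z : F → ℝ) f| ≤ ‖z‖ :=
  lp.norm_apply_le_norm ENNReal.top_ne_zero z f

/-! ### Equicontinuity of the tight Brownian bridge. -/

section BrownianBridge

variable {X : Type*} [MeasurableSpace X] {P₀ : Measure X} [IsProbabilityMeasure P₀]
  {F : Set (X → ℝ)} {Ω : Type*} [MeasurableSpace Ω] {μ : Measure Ω} [IsProbabilityMeasure μ]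
  {G₀ : Ω → EllInf F}

theorem ofReal_variance_le_eLpNorm_sq {d : X → ℝ} (hd : MemLp d 2 P₀) :
    ENNReal.ofReal (Var[d; P₀]) ≤ eLpNorm d 2 P₀ ^ 2 := by
  have h1 : Var[d; P₀] ≤ ∫ y, (d ^ 2) y ∂P₀ := variance_le_expectation_sq hd.1
  have h2 := hd.eLpNorm_eq_integral_rpow_norm two_ne_zero ENNReal.ofNat_ne_top
  have h3 : 0 ≤ ∫ y, (d ^ 2) y ∂P₀ := integral_nonneg fun y => sq_nonneg (d y)
  have h4 : ∫ a, ‖d a‖ ^ (2 : ℝ≥0∞).toReal ∂P₀ = ∫ y, (d ^ 2) y ∂P₀ := by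
    refine integral_congr_ae (ae_of_all _ fun y => ?_)
    simp
  rw [h4] at h2
  rw [h2, ← ENNReal.ofReal_pow (by positivity)]
  refine ENNReal.ofReal_le_ofReal (h1.trans (le_of_eq ?_))
  rw [← Real.rpow_natCast, ← Real.rpow_mul h3]
  simp

/-- The increments of the Brownian bridge have the variances of the index functions. -/
theorem IsBrownianBridge.variance_sub_eq (h : IsBrownianBridge P₀ F μ G₀) (f g : F) :
    Var[fun ω => (G₀ ω : F → ℝ) f - (G₀ ω : F → ℝ) g; μ] = Var[fun y => f.1 y - g.1 y; P₀] := by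
  have hL : ∀ f : F, MemLp (fun ω => (G₀ ω : F → ℝ) f) 2 μ := fun f =>
    (h.gaussian.hasGaussianLaw_eval f).memLp_two
  have hc : ∀ f g : F, cov[fun ω => (G₀ ω : F → ℝ) f, fun ω => (G₀ ω : F → ℝ) g; μ]
      = cov[f.1, g.1; P₀] := fun f g => by
    rw [h.covar, covariance_eq_sub (h.memLp f.1 f.2) (h.memLp g.1 g.2)]
    rfl
  have hv : ∀ f : F, Var[fun ω => (G₀ ω : F → ℝ) f; μ] = Var[f.1; P₀] := fun f => by
    rw [← covariance_self (hL f).1.aemeasurable, hc,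
      covariance_self (h.memLp f.1 f.2).1.aemeasurable]
  have e1 := variance_sub (hL f) (hL g)
  have e2 := variance_sub (h.memLp f.1 f.2) (h.memLp g.1 g.2)
  rw [hv, hv, hc, ← e2] at e1
  exact e1

/-- Chebyshev's inequality for a centered increment, whose variance is at most the squared
$L_2(P_0)$-distance. Gaussianity serves only to give square integrability. -/
theorem IsBrownianBridge.measure_increment_le (h : IsBrownianBridge P₀ F μ G₀) (f g : F) {c : ℝ}
    (hc : 0 < c) :
    μ {ω | c ≤ |(G₀ ω : F → ℝ) f - (G₀ ω : F → ℝ) g|} ≤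
      eLpNorm (fun y => f.1 y - g.1 y) 2 P₀ ^ 2 / ENNReal.ofReal (c ^ 2) := by
  have hL : ∀ f : F, MemLp (fun ω => (G₀ ω : F → ℝ) f) 2 μ := fun f =>
    (h.gaussian.hasGaussianLaw_eval f).memLp_two
  have hm : ∫ ω, ((G₀ ω : F → ℝ) f - (G₀ ω : F → ℝ) g) ∂μ = 0 := by
    rw [integral_sub ((hL f).integrable one_le_two) ((hL g).integrable one_le_two), h.mean, h.mean,
      sub_zero]
  have := meas_ge_le_variance_div_sq ((hL f).sub (hL g)) hc
  have hv := h.variance_sub_eq f g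
  simp only [Pi.sub_apply, hm, sub_zero] at this
  refine this.trans ?_
  rw [ENNReal.ofReal_div_of_pos (by positivity)]
  gcongr
  have e := ofReal_variance_le_eLpNorm_sq ((h.memLp f.1 f.2).sub (h.memLp g.1 g.2))
  refine le_trans (ENNReal.ofReal_le_ofReal (le_of_eq ?_)) e
  exact hv

/-- A tight Brownian bridge is stochastically equicontinuous at every point for the
`L₂(P₀)`-seminorm. -/
theorem IsBrownianBridge.exists_modulus (h : IsBrownianBridge P₀ F μ G₀) (ht : IsTightBorel μ G₀)
    (g : F) {τ : ℝ} (hτ : 0 < τ) :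
    ∃ δ : ℝ, 0 < δ ∧ μ {ω | ∃ f : F, eLpNorm (fun y => f.1 y - g.1 y) 2 P₀ < ENNReal.ofReal δ ∧
      τ < |(G₀ ω : F → ℝ) f - (G₀ ω : F → ℝ) g|} ≤ ENNReal.ofReal τ := by
  classical
  -- The filter of neighbourhoods of `g` in `F` for the $L_2(P_0)$-seminorm.
  set l : Filter F := comap (fun f : F => eLpNorm (fun y => f.1 y - g.1 y) 2 P₀) (𝓝 0) with hl
  have hlt : Tendsto (fun f : F => eLpNorm (fun y => f.1 y - g.1 y) 2 P₀) l (𝓝 0) :=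
    tendsto_comap
  have hsmall : ∀ c : ℝ, 0 < c → ∀ b : ℝ≥0∞, 0 < b →
      ∀ᶠ f in l, μ {ω | c ≤ |(G₀ ω : F → ℝ) f - (G₀ ω : F → ℝ) g|} ≤ b := by
    intro c hc b hb
    have hc2 : ENNReal.ofReal (c ^ 2) ≠ 0 := by simpa using hc.ne'
    have : Tendsto (fun f : F => eLpNorm (fun y => f.1 y - g.1 y) 2 P₀ ^ 2 / ENNReal.ofReal (c ^ 2))
        l (𝓝 0) := by
      have := ENNReal.Tendsto.div_const (ENNReal.Tendsto.pow (n := 2) hlt)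
        (b := ENNReal.ofReal (c ^ 2)) (Or.inr hc2)
      simpa using this
    filter_upwards [this.eventually_le_const hb] with f hf
    exact (h.measure_increment_le f g hc).trans hf
  -- The final chain of approximations has fewer than seven errors of size `ε`.
  set ε : ℝ := τ / 7 with hε
  have hε0 : 0 < ε := by positivity
  obtain ⟨K, hK, hKμ⟩ := ht.2 (ENNReal.ofReal (τ / 2)) (by simpa using half_pos hτ)
  obtain ⟨t, -, htfin, htK⟩ := hK.finite_cover_balls hε0
  lift t to Finset (EllInf F) using htfin
  -- An index `f` is recorded by its increments along the finitely many paths `t` that form an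
  -- `ε`-net of `K`. These vectors fill a bounded set of a finite-dimensional space, so finitely
  -- many colours `κ f` describe them up to `ε`.
  let v : F → (t → ℝ) := fun f z => (z.1 : F → ℝ) f - (z.1 : F → ℝ) g
  have hvR : ∀ f, v f ∈ Metric.closedBall (0 : t → ℝ) (∑ z ∈ t, 2 * ‖z‖) := by
    intro f
    rw [mem_closedBall_zero_iff, pi_norm_le_iff_of_nonneg (by positivity)]
    intro z
    have h1 : ‖v f z‖ ≤ 2 * ‖z.1‖ := by
      have := abs_sub ((z.1 : F → ℝ) f) ((z.1 : F → ℝ) g)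
      have h2 := EllInf.abs_apply_le z.1 f
      have h3 := EllInf.abs_apply_le z.1 g
      rw [Real.norm_eq_abs]
      change |(z.1 : F → ℝ) f - (z.1 : F → ℝ) g| ≤ _
      linarith
    exact h1.trans
      (Finset.single_le_sum (f := fun z : EllInf F => 2 * ‖z‖) (fun _ _ => by positivity) z.2)
  obtain ⟨s, -, hsfin, hsK⟩ :=
    (isCompact_closedBall (0 : t → ℝ) (∑ z ∈ t, 2 * ‖z‖)).finite_cover_balls hε0
  lift s to Finset (t → ℝ) using hsfin
  have hκ : ∀ f, ∃ c ∈ s, dist (v f) c < ε := fun f => by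
    simpa using hsK (hvR f)
  choose κ hκs hκd using hκ
  -- There are finitely many colours, so those that do not recur arbitrarily close to `g` are all
  -- absent from some neighbourhood of `g`.
  have hpers : ∀ᶠ f in l, ∃ᶠ f' in l, κ f' = κ f := by
    have : ∀ c ∈ s, ∀ᶠ f in l, κ f = c → ∃ᶠ f' in l, κ f' = c := by
      intro c _
      by_cases hc : ∃ᶠ f' in l, κ f' = c
      · exact Eventually.of_forall fun _ _ => hc
      · rw [not_frequently] at hc
        filter_upwards [hc] with f hf hf'
        exact absurd hf' hf
    rw [← Finset.eventually_all] at this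
    filter_upwards [this] with f hf
    exact hf _ (hκs f) rfl
  -- The budget `τ / 2` left over by tightness is split among the colours; the `+ 1` avoids dividing
  -- by zero.
  set b : ℝ≥0∞ := ENNReal.ofReal (τ / 2 / (s.card + 1)) with hb
  have hb0 : 0 < b := by
    rw [hb, ENNReal.ofReal_pos]; positivity
  -- A recurring colour has a representative so close to `g` that its own increment is small with
  -- high probability. For other colours the choice `g` is a dummy.
  have hrep : ∀ c : t → ℝ, ∃ f : F, (∃ᶠ f' in l, κ f' = c) →
      κ f = c ∧ μ {ω | ε ≤ |(G₀ ω : F → ℝ) f - (G₀ ω : F → ℝ) g|} ≤ b := by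
    intro c
    by_cases hc : ∃ᶠ f' in l, κ f' = c
    · obtain ⟨f, hf⟩ := (hc.and_eventually (hsmall ε hε0 b hb0)).exists
      exact ⟨f, fun _ => hf⟩
    · exact ⟨g, fun h' => absurd h' hc⟩
  choose r hr using hrep
  obtain ⟨a, ha0, ha⟩ := (ENNReal.nhds_zero_basis.comap _).eventually_iff.1 hpers
  obtain ⟨δ, hδ0, hδa⟩ := ENNReal.lt_iff_exists_nnreal_btwn.1 ha0
  refine ⟨δ, by exact_mod_cast hδ0, ?_⟩
  set s' := s.filter fun c => ∃ᶠ f' in l, κ f' = c with hs'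
  have hsub : {ω | ∃ f : F, eLpNorm (fun y => f.1 y - g.1 y) 2 P₀ < ENNReal.ofReal δ ∧
      τ < |(G₀ ω : F → ℝ) f - (G₀ ω : F → ℝ) g|} ⊆ {ω | G₀ ω ∉ K} ∪
      ⋃ c ∈ s', {ω | ε ≤ |(G₀ ω : F → ℝ) (r c) - (G₀ ω : F → ℝ) g|} := by
    rintro ω ⟨f, hfδ, hfτ⟩
    by_contra hcon
    simp only [Set.mem_union, Set.mem_ofPred_eq, Set.mem_iUnion, not_or, not_not, not_exists,
      not_le] at hcon
    obtain ⟨hωK, hω⟩ := hcon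
    have hfp : ∃ᶠ f' in l, κ f' = κ f := ha (by
      rw [ENNReal.ofReal_coe_nnreal] at hfδ
      exact hfδ.trans hδa)
    have hω' := hω (κ f) (Finset.mem_filter.2 ⟨hκs f, hfp⟩)
    obtain ⟨hrκ, -⟩ := hr (κ f) hfp
    obtain ⟨z, hz, hωz⟩ : ∃ z ∈ t, dist (G₀ ω) z < ε := by simpa using htK hωK
    have d1 := (dist_le_pi_dist (v f) (κ f) ⟨z, hz⟩).trans_lt (hκd f)
    have d2 := (dist_le_pi_dist (v (r (κ f))) (κ (r (κ f))) ⟨z, hz⟩).trans_lt (hκd (r (κ f)))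
    rw [hrκ] at d2
    have d3 := (EllInf.abs_apply_sub_le (G₀ ω) z f).trans_lt hωz
    have d4 := (EllInf.abs_apply_sub_le (G₀ ω) z g).trans_lt hωz
    have d5 := (EllInf.abs_apply_sub_le (G₀ ω) z (r (κ f))).trans_lt hωz
    rw [Real.dist_eq] at d1 d2
    simp only [v] at d1 d2
    -- `f` and its representative share a colour, so their values nearly agree along the net path
    -- `z`, hence along `G₀ ω`; the representative's increment is below `ε`.
    have : |(G₀ ω : F → ℝ) f - (G₀ ω : F → ℝ) g| < 7 * ε := by
      rw [abs_lt] at *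
      constructor <;> linarith [d1.1, d1.2, d2.1, d2.2, d3.1, d3.2, d4.1, d4.2, d5.1, d5.2,
        hω'.1, hω'.2]
    linarith
  calc _ ≤ _ := measure_mono hsub
    _ ≤ μ {ω | G₀ ω ∉ K} + ∑ c ∈ s', μ {ω | ε ≤ |(G₀ ω : F → ℝ) (r c) - (G₀ ω : F → ℝ) g|} :=
      (measure_union_le _ _).trans (by gcongr; exact measure_biUnion_finset_le _ _)
    _ ≤ ENNReal.ofReal (τ / 2) + ∑ _c ∈ s', b := by
      gcongr with c hc
      exact (hr c (Finset.mem_filter.1 hc).2).2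
    _ ≤ ENNReal.ofReal (τ / 2) + ENNReal.ofReal (τ / 2) := by
      gcongr
      rw [Finset.sum_const, nsmul_eq_mul, hb, ← ENNReal.ofReal_natCast,
        ← ENNReal.ofReal_mul (by positivity)]
      refine ENNReal.ofReal_le_ofReal ?_
      have : (s'.card : ℝ) ≤ s.card + 1 := by
        have := Finset.card_filter_le s fun c => ∃ᶠ f' in l, κ f' = c
        have : (s'.card : ℝ) ≤ s.card := by exact_mod_cast this
        linarith
      rw [mul_div_assoc', div_le_iff₀ (by positivity), mul_comm]
      gcongr
    _ = ENNReal.ofReal τ := by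
      rw [← ENNReal.ofReal_add (by positivity) (by positivity), add_halves]

end BrownianBridge

/-! ### The modulus of continuity at a point as a test function. -/

section Modulus

variable {X : Type*} [MeasurableSpace X] {F : Set (X → ℝ)}

/-- The modulus of continuity at `g` for the `L₂(P₀)`-seminorm of a bounded function on `F`. -/
noncomputable def modulusAt (P₀ : Measure X) (g : F) (δ : ℝ) (z : EllInf F) : ℝ :=
  ⨆ f : {f : F // eLpNorm (fun y => f.1 y - g.1 y) 2 P₀ < ENNReal.ofReal δ},
    |(z : F → ℝ) f.1 - (z : F → ℝ) g|

variable {P₀ : Measure X} {g : F} {δ : ℝ}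

theorem modulusAt_nonneg (z : EllInf F) : 0 ≤ modulusAt P₀ g δ z :=
  Real.iSup_nonneg fun _ => abs_nonneg _

theorem abs_sub_le_modulusAt (z : EllInf F) {f : F}
    (hf : eLpNorm (fun y => f.1 y - g.1 y) 2 P₀ < ENNReal.ofReal δ) :
    |(z : F → ℝ) f - (z : F → ℝ) g| ≤ modulusAt P₀ g δ z := by
  refine le_ciSup (f := fun f : {f : F // eLpNorm (fun y => f.1 y - g.1 y) 2 P₀ <
    ENNReal.ofReal δ} => |(z : F → ℝ) f.1 - (z : F → ℝ) g|) ⟨‖z‖ + ‖z‖, ?_⟩ ⟨f, hf⟩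
  rintro _ ⟨f, rfl⟩
  exact (abs_sub _ _).trans (add_le_add (EllInf.abs_apply_le z _) (EllInf.abs_apply_le z _))

theorem modulusAt_le_add_dist (z z' : EllInf F) :
    modulusAt P₀ g δ z ≤ modulusAt P₀ g δ z' + 2 * dist z z' := by
  refine Real.iSup_le (fun f => ?_) (add_nonneg (modulusAt_nonneg _) (by positivity))
  have h1 := abs_sub_le_modulusAt z' f.2
  have h2 := EllInf.abs_apply_sub_le z z' f.1
  have h3 := EllInf.abs_apply_sub_le z z' g
  rw [abs_le] at *
  constructor <;> linarith [h1.1, h1.2, h2.1, h2.2, h3.1, h3.2]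

/-- The modulus is 2-Lipschitz for the supremum norm, hence the division by 2. -/
theorem min_modulusAt_mem_BL₁ : (fun z : EllInf F => min 1 (modulusAt P₀ g δ z / 2)) ∈
    BL₁ (EllInf F) := by
  refine ⟨LipschitzWith.of_le_add fun z z' => ?_, fun z => ?_⟩
  · have := modulusAt_le_add_dist (P₀ := P₀) (g := g) (δ := δ) z z'
    have hd : 0 ≤ dist z z' := dist_nonneg
    rw [← min_add_add_right]
    exact min_le_min (by linarith) (by linarith)
  · have := modulusAt_nonneg (P₀ := P₀) (g := g) (δ := δ) z
    rw [abs_of_nonneg (by positivity)]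
    exact min_le_left _ _

variable [IsProbabilityMeasure P₀] {Ω : Type*} [MeasurableSpace Ω] {μ : Measure Ω}
  [IsProbabilityMeasure μ] {G₀ : Ω → EllInf F}

theorem IsBrownianBridge.exists_integral_modulusAt_le (h : IsBrownianBridge P₀ F μ G₀)
    (ht : IsTightBorel μ G₀) (g : F) {τ : ℝ} (hτ : 0 < τ) :
    ∃ δ : ℝ, 0 < δ ∧ ∫ ω, min 1 (modulusAt P₀ g δ (G₀ ω) / 2) ∂μ ≤ τ := by
  obtain ⟨δ, hδ, hle⟩ := h.exists_modulus ht g (half_pos hτ)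
  refine ⟨δ, hδ, ?_⟩
  set B := {ω | ∃ f : F, eLpNorm (fun y => f.1 y - g.1 y) 2 P₀ < ENNReal.ofReal δ ∧
      τ / 2 < |(G₀ ω : F → ℝ) f - (G₀ ω : F → ℝ) g|} with hB
  have hBm : MeasurableSet (toMeasurable μ B) := measurableSet_toMeasurable _ _
  have hI : Integrable ((toMeasurable μ B).indicator fun _ => (1 : ℝ)) μ :=
    (integrable_const 1).indicator hBm
  have hmono : ∫ ω, min 1 (modulusAt P₀ g δ (G₀ ω) / 2) ∂μ ≤
      ∫ ω, (τ / 2 + (toMeasurable μ B).indicator (fun _ => (1 : ℝ)) ω) ∂μ := by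
    -- Only the majorant has to be integrable, so measurability of the modulus along `G₀` is not
    -- required.
    refine integral_mono_of_nonneg (ae_of_all _ fun ω => ?_) ((integrable_const _).add hI)
      (ae_of_all _ fun ω => ?_)
    · have := modulusAt_nonneg (P₀ := P₀) (g := g) (δ := δ) (G₀ ω)
      change 0 ≤ min 1 (modulusAt P₀ g δ (G₀ ω) / 2)
      positivity
    · by_cases hω : ω ∈ toMeasurable μ B
      · simp only [Set.indicator_of_mem hω]
        exact (min_le_left _ _).trans (by linarith)
      · simp only [Set.indicator_of_notMem hω]
        have : modulusAt P₀ g δ (G₀ ω) ≤ τ / 2 := by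
          refine Real.iSup_le (fun f => ?_) (half_pos hτ).le
          by_contra! hcon
          exact hω (subset_toMeasurable _ _ ⟨f.1, f.2, hcon⟩)
        exact (min_le_right _ _).trans (by linarith)
  rw [integral_add (integrable_const _) hI, integral_indicator_const _ hBm] at hmono
  simp only [integral_const, probReal_univ, smul_eq_mul, one_mul, mul_one] at hmono
  rw [Measure.real, measure_toMeasurable] at hmono
  have := ENNReal.toReal_mono ENNReal.ofReal_ne_top hle
  rw [ENNReal.toReal_ofReal (half_pos hτ).le] at this
  linarith

end Modulus

/-! ### Bounds, evaluation maps and the root-n scale. -/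

theorem abs_condOuterExp_le {X : Type*} {W : ℕ → Type*} [∀ n, MeasurableSpace (W n)]
    {Q : ∀ n, Measure (W n)} [∀ n, IsProbabilityMeasure (Q n)] {n : ℕ}
    {h : (Fin n → X) → (Fin n → W n) → ℝ}
    (hh : ∀ x w, |h x w| ≤ 1) (x : Fin n → X) : |condOuterExp Q n h x| ≤ 1 :=
  abs_le.2 ⟨le_outerExp (fun w => (abs_le.1 (hh x w)).1) (fun w => (abs_le.1 (hh x w)).2),
    outerExp_le (fun w => (abs_le.1 (hh x w)).1) (fun w => (abs_le.1 (hh x w)).2)⟩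

theorem comp_apply_mem_BL₁ {X : Type*} {F : Set (X → ℝ)} (g : F) {h : ℝ → ℝ} (hh : h ∈ BL₁ ℝ) :
    (fun z : EllInf F => h ((z : F → ℝ) g)) ∈ BL₁ (EllInf F) := by
  refine ⟨LipschitzWith.of_dist_le_mul fun z z' => ?_, fun z => hh.2 _⟩
  refine (hh.1.dist_le_mul _ _).trans ?_
  gcongr
  exact EllInf.abs_apply_sub_le z z' g

theorem IsTightBorel.comp_continuous {Ω D E : Type*} [MeasurableSpace Ω] [PseudoMetricSpace D]
    [PseudoMetricSpace E] {μ : Measure Ω} {G : Ω → D} (hG : IsTightBorel μ G) {φ : D → E}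
    (hφ : Continuous φ) : IsTightBorel μ fun ω => φ (G ω) := by
  refine ⟨fun U hU => hG.1 _ (hU.preimage hφ), fun ε hε => ?_⟩
  obtain ⟨K, hK, hle⟩ := hG.2 ε hε
  exact ⟨φ '' K, hK.image hφ, (measure_mono fun ω (hω : φ (G ω) ∉ φ '' K) hωK =>
    hω ⟨_, hωK, rfl⟩).trans hle⟩

theorem EllInf.continuous_apply {X : Type*} {F : Set (X → ℝ)} (g : F) :
    Continuous fun z : EllInf F => (z : F → ℝ) g :=
  (LipschitzWith.of_dist_le_mul (K := 1) fun z z' => by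
    simpa [Real.dist_eq] using EllInf.abs_apply_sub_le z z' g).continuous

theorem bootProcess_apply {X : Type*} [MeasurableSpace X] {W : ℕ → Type*}
    [∀ n, MeasurableSpace (W n)] {Q : ∀ n, Measure (W n)} {γ : ∀ n, (Fin n → X) → W n → X} {F : Set (X → ℝ)} {n : ℕ}
    {x : Fin n → X} {w : Fin n → W n} (h : Memℓp (bootProcessFun Q γ F n x w) ∞) (f : F) :
    (bootProcess Q γ F n x w : F → ℝ) f = √(n : ℝ) * centered Q γ n x w f.1 := by
  rw [bootProcess, dif_pos h]
  rfl

theorem ofReal_mul_rpow_le_enorm_iff {n : ℕ} (hn : 0 < n) {ε : ℝ} (y : ℝ) :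
    ENNReal.ofReal (ε * (n : ℝ) ^ (-(1 / 2) : ℝ)) ≤ ‖y‖ₑ ↔ ε ≤ √(n : ℝ) * |y| := by
  have hs : 0 < √(n : ℝ) := Real.sqrt_pos.2 (by exact_mod_cast hn)
  rw [Real.enorm_eq_ofReal_abs, ENNReal.ofReal_le_ofReal_iff (abs_nonneg _),
    Real.rpow_neg (Nat.cast_nonneg n), ← Real.sqrt_eq_rpow, ← div_eq_mul_inv, div_le_iff₀' hs]

/-! ### From the limit process to the bootstrap process. -/

section Transfer

variable {X : Type*} {W : ℕ → Type*} [∀ n, MeasurableSpace (W n)]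
  {Q : ∀ n, Measure (W n)} [∀ n, IsProbabilityMeasure (Q n)]

/-- The real supremum dominates its terms only if the family is bounded; here 2 is a bound, as test
functions take values in `[-1, 1]`. -/
theorem abs_condOuterExp_sub_integral_le_iSup {Ω D : Type*} [MeasurableSpace Ω]
    [PseudoMetricSpace D] {μ : Measure Ω} [IsProbabilityMeasure μ] {n : ℕ}
    (Gn : (Fin n → X) → (Fin n → W n) → D) (G : Ω → D) (x : Fin n → X) {h : D → ℝ}
    (hh : h ∈ BL₁ D) :
    |condOuterExp Q n (fun x w => h (Gn x w)) x - ∫ ω, h (G ω) ∂μ| ≤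
      ⨆ h : BL₁ D, |condOuterExp Q n (fun x w => h.1 (Gn x w)) x - ∫ ω, h.1 (G ω) ∂μ| := by
  refine le_ciSup (f := fun h : BL₁ D =>
    |condOuterExp Q n (fun x w => h.1 (Gn x w)) x - ∫ ω, h.1 (G ω) ∂μ|) ⟨2, ?_⟩ ⟨h, hh⟩
  rintro _ ⟨h, rfl⟩
  have h1 := abs_condOuterExp_le (Q := Q) (h := fun x w => h.1 (Gn x w))
    (fun x w => h.2.2 (Gn x w)) x
  have h2 : |∫ ω, h.1 (G ω) ∂μ| ≤ 1 := by
    simpa using norm_integral_le_of_norm_le_const (μ := μ) (f := fun ω => h.1 (G ω)) (C := 1)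
      (ae_of_all _ fun ω => h.2.2 (G ω))
  exact (abs_sub _ _).trans (by linarith)

variable [MeasurableSpace X] {P₀ : Measure X} [IsProbabilityMeasure P₀] {γ : ∀ n, (Fin n → X) → W n → X}
  {F : Set (X → ℝ)} {Ω : Type*} [MeasurableSpace Ω] {μ : Measure Ω} [IsProbabilityMeasure μ]
  {G₀ : Ω → EllInf F}

/-- Conditional asymptotic linearity: the influence function estimator in the expansion may be
replaced by its limit. -/
theorem isCondLittleO_sub_centered {D : ∀ n, (Fin n → X) → (Fin n → W n) → ℝ} {φ₀ : X → ℝ}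
    (hφ₀ : φ₀ ∈ F) {φstar : ∀ n, (Fin n → X) → (Fin n → W n) → X → ℝ}
    (hφstar : TendstoInOuterProb P₀
      (fun n => condOuterProb Q n fun x => {w | φstar n x w ∉ F}) 0)
    (hG₀ : IsBrownianBridge P₀ F μ G₀) (hbdd : BootProcessInEllInf P₀ Q γ F)
    (hconv : CondWeakConv P₀ Q (bootProcess Q γ F) μ G₀)
    (hcons : IsCondLittleO P₀ Q
      (fun n x w => eLpNorm (fun y => φstar n x w y - φ₀ y) 2 P₀) fun _ => 1)
    (hrem : IsCondLittleO P₀ Q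
      (fun n x w => ‖D n x w - centered Q γ n x w (φstar n x w)‖ₑ)
      fun n => (n : ℝ) ^ (-(1 / 2) : ℝ)) :
    IsCondLittleO P₀ Q (fun n x w => ‖D n x w - centered Q γ n x w φ₀‖ₑ)
      (fun n => (n : ℝ) ^ (-(1 / 2) : ℝ)) := by
  intro ε hε
  refine tendstoInOuterProb_zero_of_le fun τ hτ => ?_
  -- The least value of the test function where the modulus is at least `ε / 2`. The limit integral
  -- is made at most `c * τ`, so that dividing by `c` in Markov's inequality leaves `τ`.
  set c : ℝ := min 1 (ε / 2 / 2) with hc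
  have hc0 : 0 < c := by positivity
  obtain ⟨δ, hδ, hint⟩ :=
    hG₀.exists_integral_modulusAt_le hconv.1 ⟨φ₀, hφ₀⟩ (mul_pos hc0 hτ)
  refine ⟨_, (((hrem (ε / 2) (half_pos hε)).add hφstar).add (hcons δ hδ)).add
    (hconv.2.const_mul (inv_pos.2 hc0)), ?_⟩
  filter_upwards [eventually_gt_atTop 0] with n hn
  filter_upwards [hbdd n hn] with x hx
  set ν := Measure.pi fun _ : Fin n => Q n with hν
  set M := {w : Fin n → W n | ε / 2 ≤ modulusAt P₀ ⟨φ₀, hφ₀⟩ δ (bootProcess Q γ F n x w)} with hM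
  have hMle : c * ν.real M ≤ c * τ + ⨆ h : BL₁ (EllInf F),
      |condOuterExp Q n (fun x w => h.1 (bootProcess Q γ F n x w)) x - ∫ ω, h.1 (G₀ ω) ∂μ| := by
    have h1 := abs_condOuterExp_sub_integral_le_iSup (Q := Q) (μ := μ) (bootProcess Q γ F n) G₀ x
      (min_modulusAt_mem_BL₁ (P₀ := P₀) (g := ⟨φ₀, hφ₀⟩) (δ := δ))
    have h2 : c * ν.real M ≤ condOuterExp Q n (fun x w =>
        min 1 (modulusAt P₀ ⟨φ₀, hφ₀⟩ δ (bootProcess Q γ F n x w) / 2)) x := by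
      refine mul_measureReal_le_outerExp (M := 1) hc0 (fun w => ?_) (fun w => min_le_left _ _)
        fun w hw => min_le_min le_rfl ?_
      · have := modulusAt_nonneg (P₀ := P₀) (g := ⟨φ₀, hφ₀⟩) (δ := δ) (bootProcess Q γ F n x w)
        positivity
      · have hw : ε / 2 ≤ modulusAt P₀ ⟨φ₀, hφ₀⟩ δ (bootProcess Q γ F n x w) := hw
        linarith
    linarith [(abs_le.1 h1).2]
  simp only [condOuterProb, outerProb_eq]
  rw [abs_of_nonneg measureReal_nonneg]
  set A := {w : Fin n → W n | ENNReal.ofReal (ε / 2 * (n : ℝ) ^ (-(1 / 2) : ℝ)) ≤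
    ‖D n x w - centered Q γ n x w (φstar n x w)‖ₑ} with hA
  set B := {w : Fin n → W n | φstar n x w ∉ F} with hB
  set C := {w : Fin n → W n | ENNReal.ofReal (δ * 1) ≤
    eLpNorm (fun y => φstar n x w y - φ₀ y) 2 P₀} with hC
  have hsub : ν.real {w | ENNReal.ofReal (ε * (n : ℝ) ^ (-(1 / 2) : ℝ)) ≤
      ‖D n x w - centered Q γ n x w φ₀‖ₑ} ≤ ν.real (A ∪ B ∪ C ∪ M) := by
    -- Off the four bad events, remainder and increment each contribute less than `ε / 2`.
    refine ENNReal.toReal_mono (measure_ne_top _ _) (measure_mono_ae ?_)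
    filter_upwards [hx.2] with w hw hεw
    change w ∈ A ∪ B ∪ C ∪ M
    by_contra hcon
    simp only [Set.mem_union, not_or] at hcon
    obtain ⟨⟨⟨hwA, hwB⟩, hwC⟩, hwM⟩ := hcon
    have hεw := (ofReal_mul_rpow_le_enorm_iff hn _).1 hεw
    have hwA : ¬ ε / 2 ≤ √(n : ℝ) * |D n x w - centered Q γ n x w (φstar n x w)| :=
      fun h' => hwA ((ofReal_mul_rpow_le_enorm_iff hn _).2 h')
    have hwB : φstar n x w ∈ F := not_not.1 hwB
    have hwC : eLpNorm (fun y => φstar n x w y - φ₀ y) 2 P₀ < ENNReal.ofReal δ := by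
      rw [← mul_one δ]; exact not_le.1 hwC
    have hwM : modulusAt P₀ ⟨φ₀, hφ₀⟩ δ (bootProcess Q γ F n x w) < ε / 2 := not_le.1 hwM
    have h1 := (abs_sub_le_modulusAt (g := ⟨φ₀, hφ₀⟩) (f := ⟨_, hwB⟩)
      (bootProcess Q γ F n x w) hwC).trans_lt hwM
    rw [bootProcess_apply hw, bootProcess_apply hw, ← mul_sub, abs_mul,
      abs_of_nonneg (Real.sqrt_nonneg _)] at h1
    have h2 := mul_le_mul_of_nonneg_left (abs_sub_le (D n x w)
      (centered Q γ n x w (φstar n x w)) (centered Q γ n x w φ₀)) (Real.sqrt_nonneg (n : ℝ))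
    rw [mul_add] at h2
    linarith [not_le.1 hwA]
  have hM' : ν.real M ≤ τ + c⁻¹ * ⨆ h : BL₁ (EllInf F),
      |condOuterExp Q n (fun x w => h.1 (bootProcess Q γ F n x w)) x - ∫ ω, h.1 (G₀ ω) ∂μ| := by
    refine le_of_mul_le_mul_left (hMle.trans (le_of_eq ?_)) hc0
    rw [mul_add, mul_inv_cancel_left₀ hc0.ne']
  have hu1 := measureReal_union_le (μ := ν) (A ∪ B ∪ C) M
  have hu2 := measureReal_union_le (μ := ν) (A ∪ B) C
  have hu3 := measureReal_union_le (μ := ν) A B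
  linarith

/-- Conditional weak convergence of a sequence that is conditionally equivalent to the empirical
process at a fixed index. -/
theorem condWeakConv_of_isCondLittleO {D : ∀ n, (Fin n → X) → (Fin n → W n) → ℝ} {φ₀ : X → ℝ}
    (hφ₀ : φ₀ ∈ F) (hbdd : BootProcessInEllInf P₀ Q γ F)
    (hconv : CondWeakConv P₀ Q (bootProcess Q γ F) μ G₀)
    (hD : IsCondLittleO P₀ Q (fun n x w => ‖D n x w - centered Q γ n x w φ₀‖ₑ)
      (fun n => (n : ℝ) ^ (-(1 / 2) : ℝ))) :
    CondWeakConv P₀ Q (fun n x w => √(n : ℝ) * D n x w) μ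
      (fun ω => (G₀ ω : F → ℝ) ⟨φ₀, hφ₀⟩) := by
  refine ⟨hconv.1.comp_continuous (EllInf.continuous_apply ⟨φ₀, hφ₀⟩),
    tendstoInOuterProb_zero_of_le fun τ hτ =>
      ⟨_, ((hD τ hτ).const_mul zero_lt_two).add hconv.2, ?_⟩⟩
  filter_upwards [eventually_gt_atTop 0] with n hn
  filter_upwards [hbdd n hn] with x hx
  set ν := Measure.pi fun _ : Fin n => Q n with hν
  have hS : 0 ≤ ⨆ h : BL₁ (EllInf F),
      |condOuterExp Q n (fun x w => h.1 (bootProcess Q γ F n x w)) x - ∫ ω, h.1 (G₀ ω) ∂μ| :=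
    Real.iSup_nonneg fun _ => abs_nonneg _
  rw [abs_of_nonneg (Real.iSup_nonneg fun _ => abs_nonneg _)]
  simp only [condOuterProb, outerProb_eq]
  set A := {w : Fin n → W n | ENNReal.ofReal (τ * (n : ℝ) ^ (-(1 / 2) : ℝ)) ≤
    ‖D n x w - centered Q γ n x w φ₀‖ₑ} with hA
  -- On this null set `bootProcess` has the default value 0 and says nothing about `centered`.
  set N := {w : Fin n → W n | ¬ Memℓp (bootProcessFun Q γ F n x w) ∞} with hN
  have hN0 : ν.real N = 0 := by
    rw [Measure.real, show ν N = 0 from hx.2, ENNReal.toReal_zero]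
  refine Real.iSup_le (fun h => ?_) (by positivity)
  have h1 := abs_condOuterExp_sub_integral_le_iSup (Q := Q) (μ := μ) (bootProcess Q γ F n) G₀ x
    (comp_apply_mem_BL₁ ⟨φ₀, hφ₀⟩ h.2)
  have h2 : |condOuterExp Q n (fun x w => h.1 (√(n : ℝ) * D n x w)) x -
      condOuterExp Q n (fun x w => h.1 ((bootProcess Q γ F n x w : F → ℝ) ⟨φ₀, hφ₀⟩)) x| ≤
      τ + 2 * ν.real (A ∪ N) := by
    refine abs_outerExp_sub_le hτ.le (fun w => h.2.2 _) (fun w => h.2.2 _) fun w hw => ?_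
    simp only [Set.mem_union, not_or] at hw
    have hwN : Memℓp (bootProcessFun Q γ F n x w) ∞ := not_not.1 hw.2
    have hwA : ¬ τ ≤ √(n : ℝ) * |D n x w - centered Q γ n x w φ₀| :=
      fun h' => hw.1 ((ofReal_mul_rpow_le_enorm_iff hn _).2 h')
    have h3 := h.2.1.dist_le_mul (√(n : ℝ) * D n x w)
      ((bootProcess Q γ F n x w : F → ℝ) ⟨φ₀, hφ₀⟩)
    rw [Real.dist_eq, Real.dist_eq, NNReal.coe_one, one_mul] at h3
    refine h3.trans ?_
    rw [bootProcess_apply hwN, ← mul_sub, abs_mul, abs_of_nonneg (Real.sqrt_nonneg _)]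
    exact (not_le.1 hwA).le
  have hu := measureReal_union_le (μ := ν) A N
  have h3 := abs_sub_le (condOuterExp Q n (fun x w => h.1 (√(n : ℝ) * D n x w)) x)
    (condOuterExp Q n (fun x w => h.1 ((bootProcess Q γ F n x w : F → ℝ) ⟨φ₀, hφ₀⟩)) x)
    (∫ ω, h.1 ((G₀ ω : F → ℝ) ⟨φ₀, hφ₀⟩) ∂μ)
  linarith

end Transfer

end CondBootstrap

theorem theorem2
    {X : Type*} [MeasurableSpace X] (P₀ : Measure X) [IsProbabilityMeasure P₀]
    -- the auxiliary randomization and the bootstrap sampling mechanism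
    {W : ℕ → Type*} [∀ n, MeasurableSpace (W n)]
    (Q : ∀ n, Measure (W n)) [∀ n, IsProbabilityMeasure (Q n)]
    (γ : ∀ n, (Fin n → X) → W n → X)
    (hγ : ∀ n, Measurable fun p : (Fin n → X) × W n => γ n p.1 p.2)
    -- the estimator construction, the nuisance estimators, the influence function and its estimator
    {H : Type*} (T : H → Measure X → ℝ) (η : ∀ n, (Fin n → X) → H)
    (ηstar : ∀ n, (Fin n → X) → (Fin n → W n) → H)
    (φ₀ : X → ℝ) (φstar : ∀ n, (Fin n → X) → (Fin n → W n) → X → ℝ)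
    -- the class `F` and the limit process
    (F : Set (X → ℝ)) (hF : ∀ f ∈ F, Measurable f)
    (hφ₀ : φ₀ ∈ F)
    (hφstar : TendstoInOuterProb P₀
      (fun n => condOuterProb Q n fun x => {w | φstar n x w ∉ F}) 0)
    {Ω : Type*} [MeasurableSpace Ω] (μ : Measure Ω) [IsProbabilityMeasure μ]
    (G₀ : Ω → EllInf F) (hG₀ : IsBrownianBridge P₀ F μ G₀)
    (hbdd : BootProcessInEllInf P₀ Q γ F)
    (hconv : CondWeakConv P₀ Q (bootProcess Q γ F) μ G₀)
    -- conditional consistency of the influence function estimator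
    (hcons : IsCondLittleO P₀ Q
      (fun n x w => eLpNorm (fun y => φstar n x w y - φ₀ y) 2 P₀) fun _ => 1)
    -- conditional negligibility of the remainder
    (hrem : IsCondLittleO P₀ Q
      (fun n x w => ‖bootRemainder Q γ T η ηstar φstar n x w‖ₑ)
      fun n => (n : ℝ) ^ (-(1 / 2) : ℝ)) :
    IsCondLittleO P₀ Q
      (fun n x w => ‖bootDiff Q γ T η ηstar n x w - centered Q γ n x w φ₀‖ₑ)
      (fun n => (n : ℝ) ^ (-(1 / 2) : ℝ)) ∧
    CondWeakConv P₀ Q (fun n x w => √(n : ℝ) * bootDiff Q γ T η ηstar n x w)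
      μ (fun ω => (G₀ ω : F → ℝ) ⟨φ₀, hφ₀⟩) := by
  -- `bootRemainder` unfolds to the difference required of `D := bootDiff`, so `hrem` applies as it
  -- stands.
  have hlin := isCondLittleO_sub_centered hφ₀ hφstar hG₀ hbdd hconv hcons hrem
  exact ⟨hlin, condWeakConv_of_isCondLittleO hφ₀ hbdd hconv hlin⟩
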